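/- Let $E$ be a real or complex Banach space and let $(e^{tD})_{t\in\mathbb{R}}$ be a strongly continuous one-parameter group of linear isometries of $E$ with infinitesimal generator $D$, that is, $Df=\lim_{t\to 0}\frac{e^{tD}f-f}{t}$ on the domain of all $f\in E$ for which this limit exists. Let $\mathcal{D}^{k}$ be the domain of $D^{k}$ and $\mathcal{D}^{\infty}=\bigcap_{k}\mathcal{D}^{k}$. For $\sigma\ge 0$ let $$\mathbf{B}_{\sigma}(D)=\{f\in\mathcal{D}^{\infty} : \|D^{k}f\|\le\sigma^{k}\|f\| \text{ for all } k\in\mathbb{N}\},$$ and for $f\in E$ let $\sigma_f$ be the smallest real number $\sigma\ge 0$ with $f\in\mathbf{B}_{\sigma}(D)$, if there is one, and $\sigma_f=\infty$ otherwise. 1. If $f\in\mathbf{B}_{\sigma}(D)$ for some $0<\sigma<\infty$, then the limit $$d_f=\lim_{k\to\infty}\|D^{k}f\|^{1/k}$$ exists (and is finite), and $d_f=\sigma_f$. 2. Conversely, if $f\in\mathcal{D}^{\infty}$ and the limit $d_f=\lim_{k\to\infty}\|D^{k}f\|^{1/k}$ exists and is finite, then $f\in\mathbf{B}_{d_f}(D)$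 and $d_f=\sigma_f$. -/

import Mathlib

open Filter Topology

namespace BernsteinVectors

/-- A strongly continuous one-parameter group of linear isometries of a normed space `E`. -/
structure IsometryGroup (𝕜 E : Type*) [RCLike 𝕜] [NormedAddCommGroup E] [NormedSpace 𝕜 E] where
  /-- the operator at time `t` -/
  op : ℝ → E →ₗᵢ[𝕜] E
  op_zero : ∀ f : E, op 0 f = f
  op_add : ∀ (s t : ℝ) (f : E), op (s + t) f = op s (op t f)
  continuous_orbit : ∀ f : E, Continuous fun t : ℝ => op t f

section Generator

variable {𝕜 E : Type*} [RCLike 𝕜] [NormedAddCommGroup E] [NormedSpace 𝕜 E]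

/-- `g` is the derivative at time `0` of the orbit of `f`, i.e. `g = lim_{t → 0} (T(t) f - f) / t`. -/
def IsGeneratorValue (T : IsometryGroup 𝕜 E) (f g : E) : Prop :=
  Tendsto (fun t : ℝ => ((t⁻¹ : ℝ) : 𝕜) • (T.op t f - f)) (𝓝[≠] 0) (𝓝 g)

theorem IsGeneratorValue.unique {T : IsometryGroup 𝕜 E} {f g₁ g₂ : E}
    (h₁ : IsGeneratorValue T f g₁) (h₂ : IsGeneratorValue T f g₂) : g₁ = g₂ :=
  tendsto_nhds_unique h₁ h₂

theorem IsGeneratorValue.zero (T : IsometryGroup 𝕜 E) : IsGeneratorValue T 0 0 := by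
  simp [IsGeneratorValue]

theorem IsGeneratorValue.add {T : IsometryGroup 𝕜 E} {f₁ f₂ g₁ g₂ : E}
    (h₁ : IsGeneratorValue T f₁ g₁) (h₂ : IsGeneratorValue T f₂ g₂) :
    IsGeneratorValue T (f₁ + f₂) (g₁ + g₂) := by
  refine (Tendsto.add h₁ h₂).congr fun t => ?_
  rw [← smul_add, map_add]
  congr 1
  abel

theorem IsGeneratorValue.smul {T : IsometryGroup 𝕜 E} {f g : E} (c : 𝕜)
    (h : IsGeneratorValue T f g) : IsGeneratorValue T (c • f) (c • g) := by
  refine (Tendsto.const_smul h c).congr fun t => ?_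
  rw [map_smul, ← smul_sub, smul_comm]

/-- The infinitesimal generator `D` of the group: its domain consists of all `f` for which
`lim_{t → 0} (T(t) f - f) / t` exists in `E`, and `D f` is this limit. -/
noncomputable def IsometryGroup.generator (T : IsometryGroup 𝕜 E) : E →ₗ.[𝕜] E where
  domain :=
    { carrier := {f | ∃ g, IsGeneratorValue T f g}
      add_mem' := by
        rintro _ _ ⟨g₁, h₁⟩ ⟨g₂, h₂⟩
        exact ⟨g₁ + g₂, h₁.add h₂⟩
      zero_mem' := ⟨0, IsGeneratorValue.zero T⟩
      smul_mem' := by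
        rintro c _ ⟨g, h⟩
        exact ⟨c • g, h.smul c⟩ }
  toFun :=
    { toFun := fun f => Exists.choose f.2
      map_add' := fun f₁ f₂ =>
        (Exists.choose_spec (f₁ + f₂).2).unique
          ((Exists.choose_spec f₁.2).add (Exists.choose_spec f₂.2))
      map_smul' := fun c f =>
        (Exists.choose_spec (c • f).2).unique ((Exists.choose_spec f.2).smul c) }

theorem IsometryGroup.mem_generator_domain (T : IsometryGroup 𝕜 E) (f : E) :
    f ∈ T.generator.domain ↔ ∃ g, IsGeneratorValue T f g := Iff.rfl

theorem IsometryGroup.generator_spec (T : IsometryGroup 𝕜 E) (f : T.generator.domain) :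
    IsGeneratorValue T (f : E) (T.generator f) :=
  Exists.choose_spec f.2

end Generator

section Powers

variable {𝕜 E : Type*} [RCLike 𝕜] [NormedAddCommGroup E] [NormedSpace 𝕜 E]

/-- The composition `B A` of unbounded operators on its natural domain
`{f ∈ dom A | A f ∈ dom B}`. -/
def opComp (B A : E →ₗ.[𝕜] E) : E →ₗ.[𝕜] E where
  domain := (B.domain.comap A.toFun).map A.domain.subtype
  toFun :=
    { toFun := fun f => B ⟨A ⟨f, by obtain ⟨x, -, hx⟩ := f.2; exact hx ▸ x.2⟩, by
        obtain ⟨_, x, hx, rfl⟩ := f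
        exact hx⟩
      map_add' := fun f g => by
        rw [← B.map_add]
        congr 1
        ext
        exact A.map_add ⟨f, _⟩ ⟨g, _⟩
      map_smul' := fun c f => by
        rw [RingHom.id_apply, ← B.map_smul]
        congr 1
        ext
        exact A.map_smul c ⟨f, _⟩ }

theorem mem_opComp_domain (B A : E →ₗ.[𝕜] E) (f : E) :
    f ∈ (opComp B A).domain ↔ ∃ h : f ∈ A.domain, A ⟨f, h⟩ ∈ B.domain := by
  constructor
  · rintro ⟨x, hx, rfl⟩
    exact ⟨x.2, hx⟩
  · rintro ⟨h, h'⟩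
    exact ⟨⟨f, h⟩, h', rfl⟩

theorem opComp_apply (B A : E →ₗ.[𝕜] E) (f : E) (h : f ∈ (opComp B A).domain)
    (h₁ : f ∈ A.domain) (h₂ : A ⟨f, h₁⟩ ∈ B.domain) :
    opComp B A ⟨f, h⟩ = B ⟨A ⟨f, h₁⟩, h₂⟩ := rfl

/-- The powers `D ^ k` of an unbounded operator: `D ^ 0` is the identity of `E`, and
`D ^ (k + 1) = D (D ^ k)` on the natural domain. -/
def opPow (D : E →ₗ.[𝕜] E) : ℕ → E →ₗ.[𝕜] E
  | 0 => (LinearMap.id : E →ₗ[𝕜] E).toPMap ⊤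
  | k + 1 => opComp D (opPow D k)

/-- The space `⋂ k, dom (D ^ k)`. -/
def smoothDomain (D : E →ₗ.[𝕜] E) : Submodule 𝕜 E :=
  ⨅ k : ℕ, (opPow D k).domain

theorem mem_opPow_domain {D : E →ₗ.[𝕜] E} {f : E} (hf : f ∈ smoothDomain D) (k : ℕ) :
    f ∈ (opPow D k).domain :=
  (Submodule.mem_iInf _).1 hf k

/-- The vector `D ^ k f`, for `f` in the domain of all powers of `D`. -/
def powApply (D : E →ₗ.[𝕜] E) (k : ℕ) (f : smoothDomain D) : E :=
  opPow D k ⟨f, mem_opPow_domain f.2 k⟩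

/-- The Bernstein space `B_σ(D)` (meant for `0 ≤ σ`): all `f ∈ ⋂ k, dom (D ^ k)` with
`‖D ^ k f‖ ≤ σ ^ k ‖f‖` for every `k`. -/
def bernsteinSpace (D : E →ₗ.[𝕜] E) (σ : ℝ) : Set E :=
  {f | ∃ h : f ∈ smoothDomain D, ∀ k : ℕ, ‖powApply D k ⟨f, h⟩‖ ≤ σ ^ k * ‖f‖}

theorem mem_smoothDomain {D : E →ₗ.[𝕜] E} {σ : ℝ} {f : E} (hf : f ∈ bernsteinSpace D σ) :
    f ∈ smoothDomain D :=
  Exists.fst hf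

open Classical in
/-- `σ_f`: the smallest real number `σ ≥ 0` with `f ∈ B_σ(D)` if there is one, and `∞` otherwise. -/
noncomputable def bernsteinIndex (D : E →ₗ.[𝕜] E) (f : E) : EReal :=
  if h : ∃ s : ℝ, IsLeast {σ : ℝ | 0 ≤ σ ∧ f ∈ bernsteinSpace D σ} s then (h.choose : EReal) else ⊤

theorem bernsteinIndex_eq_coe_iff (D : E →ₗ.[𝕜] E) (f : E) (s : ℝ) :
    bernsteinIndex D f = (s : EReal) ↔
      IsLeast {σ : ℝ | 0 ≤ σ ∧ f ∈ bernsteinSpace D σ} s := by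
  unfold bernsteinIndex
  split_ifs with h
  · rw [EReal.coe_eq_coe_iff]
    exact ⟨fun e => e ▸ h.choose_spec, fun hs => h.choose_spec.unique hs⟩
  · exact ⟨fun e => absurd e.symm (EReal.coe_ne_top s), fun hs => absurd ⟨s, hs⟩ h⟩

end Powers

end BernsteinVectors

namespace BernsteinVectors

/-! The crux is a rigidity statement: if `‖D ^ n f‖ ≤ τ ^ n` for infinitely many `n`, then `‖D ^ (j
+ 1) f‖ ≤ τ ‖D ^ j f‖` for every `j`, so `f ∈ B_τ(D)`. Pairing the orbit of `D ^ j f` with a real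
functional that norms `D ^ (j + 1) f` reduces this to Bernstein's inequality `|F'(0)| ≤ τ sup |F|`
on the line, where the derivatives of `F` are known to be small only infinitely often
(`BoundedTower.norm_deriv_le`).

That growth confines the spectrum of `F` to `[-τ, τ]`: against `𝓕 k` with `k = 0` on `|ξ| < a`, one
divides `k` by `ξ` and integrates by parts `n` times, gaining a factor close to `1 / (2πa)` each
time. M. Riesz's interpolation formula then writes `F'` as a series of differences of translates of
`F`, with constant exactly `lam` for any `lam > τ`. It comes from expanding the triangle wave in
sines.

For the theorem, the least `s` with `f ∈ B_s(D)` exists because the conditions on `σ` are closed.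
The roots have upper limit at most `s` since `‖D ^ k f‖ ≤ s ^ k ‖f‖`; if they were at most some `a <
s` infinitely often, rigidity would give `f ∈ B_a(D)`. A finite limit `d` first puts `f` in
`B_{d+1}(D)`, and then `d = s`. -/

section FourierSide

open MeasureTheory FourierTransform

/-! ### Integrable `C²` functions and their Fourier transforms -/

/-- A `C²` function on the line that is integrable together with its first two derivatives. -/
structure IntegrableC2 (k : ℝ → ℂ) : Prop where
  contDiff : ContDiff ℝ 2 k
  int : Integrable k
  int_deriv : Integrable (deriv k)
  int_deriv2 : Integrable (deriv (deriv k))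

/-- The weighted Sobolev norm `‖k‖₁ + c ‖k'‖₁ + c² ‖k''‖₁`. -/
noncomputable def c2Norm (c : ℝ) (k : ℝ → ℂ) : ℝ :=
  (∫ x, ‖k x‖) + c * (∫ x, ‖deriv k x‖) + c ^ 2 * ∫ x, ‖deriv (deriv k) x‖

namespace IntegrableC2

variable {k : ℝ → ℂ}

theorem differentiable (hk : IntegrableC2 k) : Differentiable ℝ k :=
  hk.contDiff.differentiable (by norm_num)

theorem contDiff_deriv (hk : IntegrableC2 k) : ContDiff ℝ 1 (deriv k) :=
  ((contDiff_succ_iff_deriv (n := 1)).1 (by simpa [one_add_one_eq_two] using hk.contDiff)).2.2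

theorem differentiable_deriv (hk : IntegrableC2 k) : Differentiable ℝ (deriv k) :=
  hk.contDiff_deriv.differentiable (by norm_num)

/-- Add the trivial bounds for the transforms of `k` and `k''`; the latter is `(2πx)²` times the
former in modulus, and `(2π)² ≥ 1`. -/
theorem norm_fourier_le (hk : IntegrableC2 k) (x : ℝ) :
    ‖𝓕 k x‖ ≤ ((∫ x, ‖k x‖) + ∫ x, ‖deriv (deriv k) x‖) * (1 + x ^ 2)⁻¹ := by
  have h0 : ‖𝓕 k x‖ ≤ ∫ x, ‖k x‖ :=
    VectorFourier.norm_fourierIntegral_le_integral_norm _ _ _ _ _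
  have h2 : ‖𝓕 (deriv (deriv k)) x‖ ≤ ∫ x, ‖deriv (deriv k) x‖ :=
    VectorFourier.norm_fourierIntegral_le_integral_norm _ _ _ _ _
  rw [Real.fourier_deriv hk.int_deriv hk.differentiable_deriv hk.int_deriv2,
    Real.fourier_deriv hk.int hk.differentiable hk.int_deriv] at h2
  simp only [norm_smul, norm_mul, Complex.norm_I, Complex.norm_ofNat, Complex.norm_real,
    Real.norm_eq_abs, abs_of_pos Real.pi_pos, mul_one] at h2
  have h3 : x ^ 2 * ‖𝓕 k x‖ ≤ 2 * Real.pi * |x| * (2 * Real.pi * |x| * ‖𝓕 k x‖) := by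
    have e : 2 * Real.pi * |x| * (2 * Real.pi * |x| * ‖𝓕 k x‖)
        = (2 * Real.pi) ^ 2 * (x ^ 2 * ‖𝓕 k x‖) := by
      rw [← sq_abs x]; ring
    rw [e]
    refine le_mul_of_one_le_left (by positivity) ?_
    nlinarith [Real.pi_gt_three]
  rw [← div_eq_mul_inv, le_div_iff₀ (by positivity)]
  linarith

theorem continuous_fourier (hk : IntegrableC2 k) : Continuous (𝓕 k) :=
  VectorFourier.fourierIntegral_continuous Real.continuous_fourierChar (by fun_prop) hk.int

theorem integrable_fourier (hk : IntegrableC2 k) : Integrable (𝓕 k) :=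
  (integrable_inv_one_add_sq.const_mul _).mono' hk.continuous_fourier.aestronglyMeasurable
    (Eventually.of_forall hk.norm_fourier_le)

theorem integral_norm_fourier_le (hk : IntegrableC2 k) {c : ℝ} (hc : 0 < c) :
    ∫ x, ‖𝓕 k x‖ ≤ Real.pi * (1 + (c ^ 2)⁻¹) * c2Norm c k := by
  have h : ∫ x, ‖𝓕 k x‖ ≤ ((∫ x, ‖k x‖) + ∫ x, ‖deriv (deriv k) x‖) * Real.pi := by
    rw [← integral_univ_inv_one_add_sq, ← integral_const_mul]
    exact integral_mono hk.integrable_fourier.norm (integrable_inv_one_add_sq.const_mul _)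
      hk.norm_fourier_le
  have a0 : 0 ≤ ∫ x, ‖k x‖ := by positivity
  have a1 : 0 ≤ ∫ x, ‖deriv k x‖ := by positivity
  have a2 : 0 ≤ ∫ x, ‖deriv (deriv k) x‖ := by positivity
  refine h.trans ?_
  rw [mul_comm, mul_assoc]
  refine mul_le_mul_of_nonneg_left ?_ Real.pi_pos.le
  unfold c2Norm
  generalize (∫ x, ‖k x‖) = A at *
  generalize (∫ x, ‖deriv k x‖) = B at *
  generalize (∫ x, ‖deriv (deriv k) x‖) = D at *
  have : (1 + (c ^ 2)⁻¹) * (A + c * B + c ^ 2 * D)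
      = A + D + (c * B + c ^ 2 * D + (c ^ 2)⁻¹ * (A + c * B)) := by
    field_simp
    ring
  rw [this]
  exact le_add_of_nonneg_right (by positivity)

theorem sub {l : ℝ → ℂ} (hk : IntegrableC2 k) (hl : IntegrableC2 l) : IntegrableC2 (k - l) := by
  have e1 : deriv (k - l) = deriv k - deriv l := by
    ext x
    exact deriv_sub (hk.differentiable x) (hl.differentiable x)
  have e2 : deriv (deriv k - deriv l) = deriv (deriv k) - deriv (deriv l) := by
    ext x
    exact deriv_sub (hk.differentiable_deriv x) (hl.differentiable_deriv x)
  refine ⟨hk.contDiff.sub hl.contDiff, hk.int.sub hl.int, ?_, ?_⟩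
  · rw [e1]; exact hk.int_deriv.sub hl.int_deriv
  · rw [e1, e2]; exact hk.int_deriv2.sub hl.int_deriv2

theorem of_hasCompactSupport (hk : ContDiff ℝ 2 k) (hs : HasCompactSupport k) :
    IntegrableC2 k := by
  have h1 : ContDiff ℝ 1 (deriv k) :=
    ((contDiff_succ_iff_deriv (n := 1)).1 (by simpa [one_add_one_eq_two] using hk)).2.2
  exact ⟨hk, hk.continuous.integrable_of_hasCompactSupport hs,
    h1.continuous.integrable_of_hasCompactSupport hs.deriv,
    (h1.continuous_deriv (by norm_num)).integrable_of_hasCompactSupport hs.deriv.deriv⟩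

theorem of_schwartz (η : SchwartzMap ℝ ℂ) : IntegrableC2 η := by
  have e (g : SchwartzMap ℝ ℂ) : deriv g = SchwartzMap.derivCLM ℂ ℂ g := by
    ext x
    simp
  refine ⟨η.smooth 2, η.integrable, ?_, ?_⟩
  · rw [e]; exact SchwartzMap.integrable _
  · rw [e, e]; exact SchwartzMap.integrable _

/-- The Fourier transform of `ξ k(ξ)` is, up to a constant, the derivative of that of `k`. -/
theorem hasDerivAt_fourier (hk : Integrable k) (hk' : Integrable fun ξ : ℝ => (ξ : ℂ) * k ξ)
    (x : ℝ) :
    HasDerivAt (𝓕 k) (-2 * Real.pi * Complex.I * 𝓕 (fun ξ : ℝ => (ξ : ℂ) * k ξ) x) x := by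
  have h := Real.hasDerivAt_fourier hk (by simpa [Complex.real_smul] using hk') x
  refine h.congr_deriv ?_
  rw [Real.fourier_real_eq, Real.fourier_real_eq, ← integral_const_mul]
  congr 1
  ext ξ
  simp only [Circle.smul_def, smul_eq_mul]
  ring

end IntegrableC2

/-! ### Division by the frequency -/

section Division

variable {k : ℝ → ℂ} {a : ℝ}

theorem deriv_eq_zero_of_eq_zero_of_abs_lt (hv : ∀ x, |x| < a → k x = 0) :
    ∀ x, |x| < a → deriv k x = 0 := by
  intro x hx
  have : k =ᶠ[𝓝 x] fun _ => 0 := by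
    filter_upwards [(isOpen_lt continuous_abs continuous_const).mem_nhds hx] with y hy
      using hv y hy
  rw [this.deriv_eq, deriv_const]

/-- The formula survives at `x = 0`: the quotient vanishes near `0`, and division by zero returns
`0` on the right. -/
theorem hasDerivAt_div_id {k' : ℝ → ℂ} (ha : 0 < a) (hk : ∀ x, HasDerivAt k (k' x) x)
    (hv : ∀ x, |x| < a → k x = 0) (x : ℝ) :
    HasDerivAt (fun x : ℝ => k x / x) (k' x / x - k x / (x : ℂ) ^ 2) x := by
  by_cases hx : x = 0
  · subst hx
    have : (fun x : ℝ => k x / x) =ᶠ[𝓝 0] fun _ => 0 := by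
      filter_upwards [(isOpen_lt continuous_abs continuous_const).mem_nhds
        (show |(0 : ℝ)| < a by simpa using ha)] with y hy
      rw [hv y hy, zero_div]
    simpa using (hasDerivAt_const (0 : ℝ) (0 : ℂ)).congr_of_eventuallyEq this
  · have hx' : (x : ℂ) ≠ 0 := by exact_mod_cast hx
    have h1 : HasDerivAt (fun x : ℝ => (x : ℂ)) 1 x := Complex.ofRealCLM.hasDerivAt
    refine ((hk x).div h1 hx').congr_deriv ?_
    field_simp

theorem norm_div_pow_le (ha : 0 < a) (hv : ∀ x, |x| < a → k x = 0) (n : ℕ) (x : ℝ) :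
    ‖k x / (x : ℂ) ^ n‖ ≤ (a ^ n)⁻¹ * ‖k x‖ := by
  by_cases hx : |x| < a
  · simp [hv x hx]
  · rw [norm_div, norm_pow, Complex.norm_real, Real.norm_eq_abs, div_eq_inv_mul]
    have := not_lt.1 hx
    gcongr

theorem contDiff_div_id (ha : 0 < a) {n : ℕ} (hk : ContDiff ℝ n k)
    (hv : ∀ x, |x| < a → k x = 0) : ContDiff ℝ n (fun x : ℝ => k x / x) := by
  rw [contDiff_iff_contDiffAt]
  intro x
  by_cases hx : x = 0
  · subst hx
    have : (fun x : ℝ => k x / x) =ᶠ[𝓝 0] fun _ => 0 := by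
      filter_upwards [(isOpen_lt continuous_abs continuous_const).mem_nhds
        (show |(0 : ℝ)| < a by simpa using ha)] with y hy
      rw [hv y hy, zero_div]
    exact contDiffAt_const.congr_of_eventuallyEq this
  · have hx' : (x : ℂ) ≠ 0 := by exact_mod_cast hx
    have h1 : ContDiffAt ℝ n (fun x : ℝ => (x : ℂ)) x := Complex.ofRealCLM.contDiff.contDiffAt
    simp only [div_eq_mul_inv]
    exact hk.contDiffAt.mul (h1.inv hx')

theorem integrable_div_pow (ha : 0 < a) (hk : Integrable k) (hv : ∀ x, |x| < a → k x = 0) (n : ℕ) :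
    Integrable fun x : ℝ => k x / (x : ℂ) ^ n :=
  (hk.norm.const_mul _).mono'
    (hk.1.aemeasurable.div (by fun_prop)).aestronglyMeasurable
    (Eventually.of_forall (norm_div_pow_le ha hv n))

theorem integral_norm_div_pow_le (ha : 0 < a) (hk : Integrable k) (hv : ∀ x, |x| < a → k x = 0)
    (n : ℕ) : ∫ x : ℝ, ‖k x / (x : ℂ) ^ n‖ ≤ (a ^ n)⁻¹ * ∫ x, ‖k x‖ := by
  rw [← integral_const_mul]
  exact integral_mono (integrable_div_pow ha hk hv n).norm (hk.norm.const_mul _)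
    (norm_div_pow_le ha hv n)

/-- The weight `c` makes the cost of one division tend to the optimal `1 / a` as `c → 0`: each
derivative that falls on `1 / x` costs another `1 / a` but is paid for by a factor `c`. -/
theorem IntegrableC2.div_id (ha : 0 < a) (hk : IntegrableC2 k) (hv : ∀ x, |x| < a → k x = 0) {c : ℝ}
    (hc : 0 < c) :
    IntegrableC2 (fun x : ℝ => k x / x) ∧
      c2Norm c (fun x : ℝ => k x / x) ≤
        (a⁻¹ + 2 * c * (a ^ 2)⁻¹ + 2 * c ^ 2 * (a ^ 3)⁻¹) * c2Norm c k := by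
  have hv1 := deriv_eq_zero_of_eq_zero_of_abs_lt hv
  have hv2 := deriv_eq_zero_of_eq_zero_of_abs_lt hv1
  have hvd : ∀ x : ℝ, |x| < a → k x / x = 0 := fun x hx => by rw [hv x hx, zero_div]
  have hk0 : ∀ x, HasDerivAt k (deriv k x) x := fun x => (hk.differentiable x).hasDerivAt
  have hk1 : ∀ x, HasDerivAt (deriv k) (deriv (deriv k) x) x :=
    fun x => (hk.differentiable_deriv x).hasDerivAt
  have e1 : deriv (fun x : ℝ => k x / x) =
      fun x : ℝ => deriv k x / (x : ℂ) ^ 1 - k x / (x : ℂ) ^ 2 := by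
    ext x
    rw [(hasDerivAt_div_id ha hk0 hv x).deriv, pow_one]
  have e2 : deriv (fun x : ℝ => deriv k x / (x : ℂ) ^ 1 - k x / (x : ℂ) ^ 2) =
      fun x : ℝ => deriv (deriv k) x / (x : ℂ) ^ 1 - 2 * (deriv k x / (x : ℂ) ^ 2)
        + 2 * (k x / (x : ℂ) ^ 3) := by
    ext x
    have h1 := hasDerivAt_div_id ha hk1 hv1 x
    have h2 := hasDerivAt_div_id ha (hasDerivAt_div_id ha hk0 hv) hvd x
    have h3 := h1.sub h2
    have e : (fun x : ℝ => deriv k x / (x : ℂ) ^ 1 - k x / (x : ℂ) ^ 2) =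
        (fun x : ℝ => deriv k x / (x : ℂ)) - fun x : ℝ => k x / x / x := by
      ext x
      simp [div_div, pow_two]
    rw [e, h3.deriv]
    by_cases hx : x = 0
    · subst hx; simp
    · have hx' : (x : ℂ) ≠ 0 := by exact_mod_cast hx
      field_simp
      ring
  have i0 := integrable_div_pow ha hk.int hv
  have i1 := integrable_div_pow ha hk.int_deriv hv1
  have i2 := integrable_div_pow ha hk.int_deriv2 hv2
  have I1 : Integrable (deriv (fun x : ℝ => k x / x)) := by
    rw [e1]; exact (i1 1).sub (i0 2)
  have I2 : Integrable (deriv (deriv (fun x : ℝ => k x / x))) := by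
    rw [e1, e2]; exact ((i2 1).sub ((i1 2).const_mul 2)).add ((i0 3).const_mul 2)
  refine ⟨⟨contDiff_div_id (n := 2) ha hk.contDiff hv, by simpa using i0 1, I1, I2⟩, ?_⟩
  have b0 : ∫ x : ℝ, ‖k x / x‖ ≤ a⁻¹ * ∫ x, ‖k x‖ := by
    simpa using integral_norm_div_pow_le ha hk.int hv 1
  have b1 : ∫ x : ℝ, ‖deriv (fun x : ℝ => k x / x) x‖ ≤
      a⁻¹ * (∫ x, ‖deriv k x‖) + (a ^ 2)⁻¹ * ∫ x, ‖k x‖ := by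
    calc ∫ x : ℝ, ‖deriv (fun x : ℝ => k x / x) x‖
        ≤ ∫ x : ℝ, (‖deriv k x / (x : ℂ) ^ 1‖ + ‖k x / (x : ℂ) ^ 2‖) :=
          integral_mono I1.norm ((i1 1).norm.add (i0 2).norm)
            (fun x => by rw [e1]; exact norm_sub_le _ _)
      _ = (∫ x : ℝ, ‖deriv k x / (x : ℂ) ^ 1‖) + ∫ x : ℝ, ‖k x / (x : ℂ) ^ 2‖ :=
          integral_add (i1 1).norm (i0 2).norm
      _ ≤ _ := by
          have := integral_norm_div_pow_le ha hk.int_deriv hv1 1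
          rw [pow_one] at this
          exact add_le_add this (integral_norm_div_pow_le ha hk.int hv 2)
  have b2 : ∫ x : ℝ, ‖deriv (deriv (fun x : ℝ => k x / x)) x‖ ≤
      a⁻¹ * (∫ x, ‖deriv (deriv k) x‖) + 2 * ((a ^ 2)⁻¹ * ∫ x, ‖deriv k x‖)
        + 2 * ((a ^ 3)⁻¹ * ∫ x, ‖k x‖) := by
    calc ∫ x : ℝ, ‖deriv (deriv (fun x : ℝ => k x / x)) x‖
        ≤ ∫ x : ℝ, (‖deriv (deriv k) x / (x : ℂ) ^ 1‖ + 2 * ‖deriv k x / (x : ℂ) ^ 2‖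
            + 2 * ‖k x / (x : ℂ) ^ 3‖) := by
          refine integral_mono I2.norm
            (((i2 1).norm.add ((i1 2).norm.const_mul 2)).add ((i0 3).norm.const_mul 2))
            (fun x => ?_)
          rw [e1, e2]
          refine (norm_add_le _ _).trans ?_
          refine add_le_add ((norm_sub_le _ _).trans_eq ?_) (le_of_eq ?_)
          · rw [norm_mul, Complex.norm_ofNat]
          · rw [norm_mul, Complex.norm_ofNat]
      _ = (∫ x : ℝ, ‖deriv (deriv k) x / (x : ℂ) ^ 1‖)
            + 2 * (∫ x : ℝ, ‖deriv k x / (x : ℂ) ^ 2‖)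
            + 2 * ∫ x : ℝ, ‖k x / (x : ℂ) ^ 3‖ := by
          rw [integral_add (f := fun x : ℝ => ‖deriv (deriv k) x / (x : ℂ) ^ 1‖
              + 2 * ‖deriv k x / (x : ℂ) ^ 2‖)
            ((i2 1).norm.add ((i1 2).norm.const_mul 2)) ((i0 3).norm.const_mul 2),
            integral_add (i2 1).norm ((i1 2).norm.const_mul 2), integral_const_mul,
            integral_const_mul]
      _ ≤ _ := by
          have h2 := integral_norm_div_pow_le ha hk.int_deriv2 hv2 1
          rw [pow_one] at h2
          have h1 := integral_norm_div_pow_le ha hk.int_deriv hv1 2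
          have h0 := integral_norm_div_pow_le ha hk.int hv 3
          linarith
  have a0 : 0 ≤ ∫ x, ‖k x‖ := by positivity
  have a1 : 0 ≤ ∫ x, ‖deriv k x‖ := by positivity
  have a2 : 0 ≤ ∫ x, ‖deriv (deriv k) x‖ := by positivity
  unfold c2Norm
  generalize (∫ x, ‖k x‖) = A at *
  generalize (∫ x, ‖deriv k x‖) = B at *
  generalize (∫ x, ‖deriv (deriv k) x‖) = D at *
  refine (add_le_add (add_le_add b0 (mul_le_mul_of_nonneg_left b1 hc.le))
    (mul_le_mul_of_nonneg_left b2 (sq_nonneg c))).trans (sub_nonneg.1 ?_)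
  have : 0 ≤ c * (a ^ 2)⁻¹ * A + 2 * c ^ 2 * (a ^ 3)⁻¹ * (c * B)
      + (2 * c * (a ^ 2)⁻¹ + 2 * c ^ 2 * (a ^ 3)⁻¹) * (c ^ 2 * D) := by positivity
  refine this.trans_eq ?_
  ring

end Division

/-! ### Towers of bounded derivatives and their spectrum -/

/-- `F n` is the `n`-th derivative of `F 0`, and `M n` bounds it uniformly. -/
structure BoundedTower (F : ℕ → ℝ → ℂ) (M : ℕ → ℝ) : Prop where
  hasDerivAt : ∀ n x, HasDerivAt (F n) (F (n + 1) x) x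
  norm_le : ∀ n x, ‖F n x‖ ≤ M n

namespace BoundedTower

variable {F : ℕ → ℝ → ℂ} {M : ℕ → ℝ}

theorem continuous (hF : BoundedTower F M) (n : ℕ) : Continuous (F n) :=
  continuous_iff_continuousAt.2 fun x => (hF.hasDerivAt n x).continuousAt

theorem nonneg (hF : BoundedTower F M) (n : ℕ) : 0 ≤ M n :=
  (norm_nonneg _).trans (hF.norm_le n 0)

theorem shift (hF : BoundedTower F M) :
    BoundedTower (fun n => F (n + 1)) (fun n => M (n + 1)) :=
  ⟨fun n => hF.hasDerivAt (n + 1), fun n => hF.norm_le (n + 1)⟩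

/-- Symmetric differences of a tower obey the same bounds. -/
theorem symmDiff (hF : BoundedTower F M) (t : ℝ) :
    BoundedTower (fun n x => (F n (x - t) - F n (x + t)) / 2) M where
  hasDerivAt n x := by
    have h1 : HasDerivAt (fun x => F n (x - t)) (F (n + 1) (x - t)) x :=
      (hF.hasDerivAt n (x - t)).comp_sub_const x t
    have h2 : HasDerivAt (fun x => F n (x + t)) (F (n + 1) (x + t)) x :=
      (hF.hasDerivAt n (x + t)).comp_add_const x t
    exact (h1.sub h2).div_const 2
  norm_le n x := by
    rw [norm_div, Complex.norm_ofNat, div_le_iff₀ two_pos, mul_two]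
    exact (norm_sub_le _ _).trans (add_le_add (hF.norm_le _ _) (hF.norm_le _ _))

theorem integrable_mul (hF : BoundedTower F M) (n : ℕ) {κ : ℝ → ℂ} (hκ : Integrable κ) :
    Integrable fun x => F n x * κ x :=
  hκ.bdd_mul (hF.continuous n).aestronglyMeasurable (Eventually.of_forall (hF.norm_le n))

theorem norm_integral_mul_le (hF : BoundedTower F M) (n : ℕ) {κ : ℝ → ℂ} (hκ : Integrable κ) :
    ‖∫ x, F n x * κ x‖ ≤ M n * ∫ x, ‖κ x‖ := by
  rw [← integral_const_mul]
  refine norm_integral_le_of_norm_le (hκ.norm.const_mul _) (Eventually.of_forall fun x => ?_)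
  rw [norm_mul]
  exact mul_le_mul_of_nonneg_right (hF.norm_le n x) (norm_nonneg _)

theorem integral_mul_deriv (hF : BoundedTower F M) {κ κ' : ℝ → ℂ}
    (hκ : ∀ x, HasDerivAt κ (κ' x) x) (hi : Integrable κ) (hi' : Integrable κ') :
    ∫ x, F 0 x * κ' x = -∫ x, F 1 x * κ x :=
  integral_mul_deriv_eq_deriv_mul_of_integrable (fun x _ => hF.hasDerivAt 0 x) (fun x _ => hκ x)
    (hF.integrable_mul 0 hi') (hF.integrable_mul 1 hi) (hF.integrable_mul 0 hi)

/-- Dividing by the frequency `n` times bounds the pairing of `F 0` with a function whose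
Fourier transform vanishes near `0`. -/
theorem norm_integral_mul_fourier_le {a c : ℝ} (ha : 0 < a) (hc : 0 < c) (n : ℕ) :
    ∀ {F : ℕ → ℝ → ℂ} {M : ℕ → ℝ}, BoundedTower F M → ∀ {k : ℝ → ℂ}, IntegrableC2 k →
      (∀ x, |x| < a → k x = 0) →
      ‖∫ x, F 0 x * 𝓕 k x‖ ≤
        M n * (((a⁻¹ + 2 * c * (a ^ 2)⁻¹ + 2 * c ^ 2 * (a ^ 3)⁻¹) / (2 * Real.pi)) ^ n
          * (Real.pi * (1 + (c ^ 2)⁻¹) * c2Norm c k)) := by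
  induction n with
  | zero =>
    intro F M hF k hk _
    rw [pow_zero, one_mul]
    exact (hF.norm_integral_mul_le 0 hk.integrable_fourier).trans
      (mul_le_mul_of_nonneg_left (hk.integral_norm_fourier_le hc) (hF.nonneg 0))
  | succ n ih =>
    intro F M hF k hk hv
    set q := a⁻¹ + 2 * c * (a ^ 2)⁻¹ + 2 * c ^ 2 * (a ^ 3)⁻¹ with hq
    obtain ⟨hl, hle⟩ := hk.div_id ha hv hc
    have hvl : ∀ x : ℝ, |x| < a → k x / x = 0 := fun x hx => by rw [hv x hx, zero_div]
    -- Since `k = ξ · (k / ξ)`, `𝓕 k` is a multiple of the derivative of `𝓕 (k / ξ)`; integration by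
    -- parts moves this derivative onto `F`, and induction applies to the shifted tower.
    have e : (fun x : ℝ => (x : ℂ) * (k x / x)) = k := by
      ext x
      by_cases hx : x = 0
      · rw [hv x (by simpa [hx] using ha)]; simp
      · have hx' : (x : ℂ) ≠ 0 := by exact_mod_cast hx
        field_simp
    have hd := IntegrableC2.hasDerivAt_fourier hl.int (by rw [e]; exact hk.int)
    rw [e] at hd
    have hp := hF.integral_mul_deriv hd hl.integrable_fourier (hk.integrable_fourier.const_mul _)
    have h1 := ih hF.shift hl hvl
    have e2 : ∫ x, F 0 x * (-2 * Real.pi * Complex.I * 𝓕 k x)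
        = (-2 * Real.pi * Complex.I) * ∫ x, F 0 x * 𝓕 k x := by
      rw [← integral_const_mul]
      congr 1
      ext x
      ring
    rw [e2] at hp
    have hp' := congrArg norm hp
    rw [norm_neg, norm_mul] at hp'
    have e3 : ‖(-2 * Real.pi * Complex.I : ℂ)‖ = 2 * Real.pi := by
      simp [abs_of_pos Real.pi_pos]
    rw [e3] at hp'
    have hM := hF.nonneg (n + 1)
    have hq0 : 0 ≤ q := by positivity
    have h2 : 2 * Real.pi * ‖∫ x, F 0 x * 𝓕 k x‖ ≤
        M (n + 1) * ((q / (2 * Real.pi)) ^ n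
          * (Real.pi * (1 + (c ^ 2)⁻¹) * (q * c2Norm c k))) := by
      rw [hp']
      refine h1.trans (mul_le_mul_of_nonneg_left (mul_le_mul_of_nonneg_left
        (mul_le_mul_of_nonneg_left hle ?_) ?_) hM) <;> positivity
    have hpi := Real.pi_pos
    rw [← le_div_iff₀' (by positivity)] at h2
    refine h2.trans_eq ?_
    rw [pow_succ (q / (2 * Real.pi)) n]
    field_simp

/-- If `‖F⁽ⁿ⁾‖ ≤ C τ ^ n` for infinitely many `n`, then the spectrum of `F` lies in
`[-τ, τ]`. -/
theorem integral_mul_fourier_eq_zero (hF : BoundedTower F M) {C τ a : ℝ} (hτ : 0 ≤ τ)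
    (ha : τ < 2 * Real.pi * a) (hM : ∃ᶠ n in atTop, M n ≤ C * τ ^ n) {k : ℝ → ℂ}
    (hk : IntegrableC2 k) (hv : ∀ x, |x| < a → k x = 0) : ∫ x, F 0 x * 𝓕 k x = 0 := by
  have hpi := Real.pi_pos
  have ha0 : 0 < a := pos_of_mul_pos_right (hτ.trans_lt ha) (by positivity)
  -- At `c = 0` the left side is `τ / (2πa) < 1`, so by continuity some small `c > 0` works.
  obtain ⟨c, hc, hc1⟩ : ∃ c : ℝ, 0 < c ∧
      τ * ((a⁻¹ + 2 * c * (a ^ 2)⁻¹ + 2 * c ^ 2 * (a ^ 3)⁻¹) / (2 * Real.pi)) < 1 := by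
    have hcont : Continuous fun c : ℝ =>
        τ * ((a⁻¹ + 2 * c * (a ^ 2)⁻¹ + 2 * c ^ 2 * (a ^ 3)⁻¹) / (2 * Real.pi)) := by fun_prop
    have h0 : τ * ((a⁻¹ + 2 * 0 * (a ^ 2)⁻¹ + 2 * 0 ^ 2 * (a ^ 3)⁻¹) / (2 * Real.pi)) < 1 := by
      have : τ * ((a⁻¹ + 2 * 0 * (a ^ 2)⁻¹ + 2 * 0 ^ 2 * (a ^ 3)⁻¹) / (2 * Real.pi))
          = τ / (2 * Real.pi * a) := by
        field_simp
        ring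
      rw [this, div_lt_one (by positivity)]
      exact ha
    have hev := (hcont.tendsto 0).eventually (gt_mem_nhds h0)
    obtain ⟨c, h1, h2⟩ :=
      ((hev.filter_mono nhdsWithin_le_nhds).and (self_mem_nhdsWithin (s := Set.Ioi (0 : ℝ)))).exists
    exact ⟨c, h2, h1⟩
  set r := (a⁻¹ + 2 * c * (a ^ 2)⁻¹ + 2 * c ^ 2 * (a ^ 3)⁻¹) / (2 * Real.pi) with hr
  have hr0 : 0 ≤ r := by positivity
  set X := Real.pi * (1 + (c ^ 2)⁻¹) * c2Norm c k with hX
  have hX0 : 0 ≤ X := by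
    have : 0 ≤ c2Norm c k := by unfold c2Norm; positivity
    positivity
  have hlim : Tendsto (fun n : ℕ => C * X * (τ * r) ^ n) atTop (𝓝 0) := by
    simpa using (tendsto_pow_atTop_nhds_zero_of_lt_one (by positivity) hc1).const_mul (C * X)
  have hle : ‖∫ x, F 0 x * 𝓕 k x‖ ≤ 0 := by
    refine ge_of_tendsto_of_frequently hlim (hM.mono fun n hn => ?_)
    refine (norm_integral_mul_fourier_le ha0 hc n hF hk hv).trans ?_
    refine (mul_le_mul_of_nonneg_right hn (by positivity)).trans_eq ?_
    rw [mul_pow]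
    ring
  exact norm_le_zero_iff.1 hle

end BoundedTower

/-! ### The triangle wave and Riesz interpolation -/

/-- The coefficients of the Fourier expansion of the triangle wave. -/
noncomputable def triangleCoeff (j : ℕ) : ℝ :=
  4 / Real.pi * ((-1) ^ j / (2 * j + 1) ^ 2)

theorem cos_odd_mul_pi_div_two_sub (j : ℕ) (u : ℝ) :
    Real.cos ((2 * j + 1) * (Real.pi / 2 - u)) = (-1) ^ j * Real.sin ((2 * j + 1) * u) := by
  have h : (2 * (j : ℝ) + 1) * (Real.pi / 2 - u) = (Real.pi / 2 - (2 * j + 1) * u) + j * Real.pi := by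
    ring
  rw [h, Real.cos_add_nat_mul_pi, Real.cos_pi_div_two_sub]

theorem hasSum_cos_div_sq {x : ℝ} (hx : x ∈ Set.Icc (0 : ℝ) 1) :
    HasSum (fun n : ℕ => 1 / (n : ℝ) ^ 2 * Real.cos (2 * Real.pi * n * x))
      (Real.pi ^ 2 * (x ^ 2 - x + 1 / 6)) := by
  have h := hasSum_one_div_nat_pow_mul_cos one_ne_zero hx
  have e : (Polynomial.map (algebraMap ℚ ℝ) (Polynomial.bernoulli (2 * 1))).eval x
      = x ^ 2 - x + 1 / 6 := by
    simp [Polynomial.bernoulli, Finset.sum_range_succ, bernoulli_one, bernoulli_two,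
      Nat.choose]
    ring
  rw [e] at h
  convert h using 1
  simp
  ring

/-- Subtract the even-indexed terms, which are a quarter of the full series at `2x`; this is why `x
≤ 1 / 2` is required. -/
theorem hasSum_cos_odd_div_sq {x : ℝ} (h0 : 0 ≤ x) (h1 : x ≤ 1 / 2) :
    HasSum (fun j : ℕ => 1 / (2 * (j : ℝ) + 1) ^ 2 * Real.cos (2 * Real.pi * (2 * j + 1) * x))
      (Real.pi ^ 2 * (1 / 8 - x / 2)) := by
  have hA := hasSum_cos_div_sq (x := x) ⟨h0, by linarith⟩
  have hE := (hasSum_cos_div_sq (x := 2 * x) ⟨by linarith, by linarith⟩).mul_left (1 / 4)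
  set f : ℕ → ℝ := fun n => 1 / (n : ℝ) ^ 2 * Real.cos (2 * Real.pi * n * x) with hf
  have hE' : HasSum (fun j : ℕ => f (2 * j))
      (1 / 4 * (Real.pi ^ 2 * ((2 * x) ^ 2 - 2 * x + 1 / 6))) := by
    refine Eq.subst (motive := fun f : ℕ → ℝ => HasSum f _) (funext fun j => Eq.symm ?_) hE
    have e : 2 * Real.pi * ((2 * j : ℕ) : ℝ) * x = 2 * Real.pi * j * (2 * x) := by
      push_cast
      ring
    simp only [hf]
    rw [e]
    push_cast
    rw [mul_pow, one_div, one_div, mul_inv]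
    ring
  have hO : Summable (fun j : ℕ => f (2 * j + 1)) :=
    hA.summable.comp_injective (i := fun j : ℕ => 2 * j + 1) fun a b h => by
      simpa using h
  have h := (HasSum.even_add_odd (f := f) hE' hO.hasSum).unique hA
  have h2 := hO.hasSum
  rw [eq_sub_of_add_eq' h] at h2
  have e : Real.pi ^ 2 * (x ^ 2 - x + 1 / 6) -
      1 / 4 * (Real.pi ^ 2 * ((2 * x) ^ 2 - 2 * x + 1 / 6)) = Real.pi ^ 2 * (1 / 8 - x / 2) := by
    ring
  rw [e] at h2
  refine Eq.subst (motive := fun f : ℕ → ℝ => HasSum f _) (funext fun j => Eq.symm ?_) h2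
  simp only [hf]
  push_cast
  rfl

/-- The Fourier expansion of the triangle wave, near `0`. -/
theorem hasSum_triangleCoeff_mul_sin {u : ℝ} (hu : |u| ≤ Real.pi / 2) :
    HasSum (fun j : ℕ => triangleCoeff j * Real.sin ((2 * j + 1) * u)) u := by
  have hpi := Real.pi_pos
  obtain ⟨h1, h2⟩ := abs_le.1 hu
  have hx0 : 0 ≤ (Real.pi / 2 - u) / (2 * Real.pi) := by
    apply div_nonneg <;> linarith
  have hx1 : (Real.pi / 2 - u) / (2 * Real.pi) ≤ 1 / 2 := by
    rw [div_le_iff₀ (by positivity)]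
    linarith
  have h := (hasSum_cos_odd_div_sq hx0 hx1).mul_left (4 / Real.pi)
  have e : 4 / Real.pi * (Real.pi ^ 2 * (1 / 8 - (Real.pi / 2 - u) / (2 * Real.pi) / 2)) = u := by
    field_simp
    ring
  rw [e] at h
  refine Eq.subst (motive := fun f : ℕ → ℝ => HasSum f _) (funext fun j => Eq.symm ?_) h
  have e2 : 2 * Real.pi * (2 * (j : ℝ) + 1) * ((Real.pi / 2 - u) / (2 * Real.pi))
      = (2 * j + 1) * (Real.pi / 2 - u) := by
    field_simp
  rw [e2, cos_odd_mul_pi_div_two_sub]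
  unfold triangleCoeff
  ring

/-- At the peak `u = π / 2` every sine equals `(-1) ^ j`, which cancels the sign of the coefficient.
-/
theorem hasSum_abs_triangleCoeff : HasSum (fun j => |triangleCoeff j|) (Real.pi / 2) := by
  have hpi := Real.pi_pos
  have h := hasSum_triangleCoeff_mul_sin (u := Real.pi / 2) (abs_of_pos (by positivity)).le
  refine Eq.subst (motive := fun f : ℕ → ℝ => HasSum f _) (funext fun j => Eq.symm ?_) h
  have e := cos_odd_mul_pi_div_two_sub j (Real.pi / 2)
  rw [sub_self, mul_zero, Real.cos_zero] at e
  have e1 : |triangleCoeff j| = 4 / Real.pi * (1 / (2 * j + 1) ^ 2) := by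
    unfold triangleCoeff
    rw [abs_mul, abs_of_pos (by positivity : 0 < 4 / Real.pi), abs_div, abs_neg_one_pow,
      abs_of_pos (by positivity : (0 : ℝ) < (2 * j + 1) ^ 2)]
  rw [e1]
  unfold triangleCoeff
  linear_combination (4 / Real.pi * (1 / (2 * j + 1) ^ 2)) * e

/-- The Riesz interpolation formula for the derivative of a function with spectrum in
`[-lam, lam]`, whose nodes are the odd multiples of `s = π / (2 lam)`. -/
theorem hasSum_riesz_fourier {lam s : ℝ} (hlam : 0 < lam) (hs : s = Real.pi / (2 * lam))
    {k : ℝ → ℂ} (hk : Integrable k) (hsupp : ∀ ξ, lam < 2 * Real.pi * |ξ| → k ξ = 0) (x : ℝ) :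
    HasSum (fun j : ℕ => (triangleCoeff j : ℂ) *
        ((𝓕 k (x + (2 * j + 1) * s) - 𝓕 k (x - (2 * j + 1) * s)) / 2))
      (s * (-2 * Real.pi * Complex.I * 𝓕 (fun ξ : ℝ => (ξ : ℂ) * k ξ) x)) := by
  have hpi := Real.pi_pos
  have hs0 : 0 < s := by rw [hs]; positivity
  set e : ℝ → ℝ → ℂ := fun y ξ => Complex.exp (↑(-2 * Real.pi * ξ * y) * Complex.I) with he
  have hF (f : ℝ → ℂ) (y : ℝ) : 𝓕 f y = ∫ ξ, e y ξ * f ξ := by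
    rw [Real.fourier_real_eq_integral_exp_smul]
    rfl
  have hec (y : ℝ) : Continuous (e y) := by
    simp only [he]
    fun_prop
  have hen (y ξ : ℝ) : ‖e y ξ‖ ≤ 1 := (Complex.norm_exp_ofReal_mul_I _).le
  have hei (y : ℝ) : Integrable fun ξ => e y ξ * k ξ :=
    hk.bdd_mul (hec y).aestronglyMeasurable (Eventually.of_forall (hen y))
  set G : ℕ → ℝ → ℂ := fun j ξ => (triangleCoeff j : ℂ) *
    ((Real.sin ((2 * j + 1) * (2 * Real.pi * ξ * s)) : ℂ) * (-Complex.I * (e x ξ * k ξ))) with hG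
  have hsinc (j : ℕ) : Continuous fun ξ : ℝ =>
      (Real.sin ((2 * j + 1) * (2 * Real.pi * ξ * s)) : ℂ) := by fun_prop
  have hGi (j : ℕ) : Integrable (G j) := by
    refine Integrable.const_mul (Integrable.bdd_mul (c := 1) ((hei x).const_mul _)
      (hsinc j).aestronglyMeasurable (Eventually.of_forall fun ξ => ?_)) _
    rw [Complex.norm_real]
    exact Real.abs_sin_le_one _
  have hGle (j : ℕ) (ξ : ℝ) : ‖G j ξ‖ ≤ |triangleCoeff j| * ‖k ξ‖ := by
    simp only [hG, norm_mul, norm_neg, Complex.norm_I, Complex.norm_real, Real.norm_eq_abs, one_mul]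
    refine mul_le_mul_of_nonneg_left ?_ (abs_nonneg _)
    calc _ ≤ 1 * (1 * ‖k ξ‖) := by
          gcongr
          · exact Real.abs_sin_le_one _
          · exact hen _ _
      _ = ‖k ξ‖ := by ring
  have hGs : Summable fun j => ∫ ξ, ‖G j ξ‖ := by
    refine Summable.of_nonneg_of_le (fun j => by positivity) (fun j => ?_)
      (hasSum_abs_triangleCoeff.summable.mul_right (∫ ξ, ‖k ξ‖))
    rw [← integral_const_mul]
    exact integral_mono (hGi j).norm (hk.norm.const_mul _) (hGle j)
  have hsum := hasSum_integral_of_summable_integral_norm hGi hGs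
  have hterm (j : ℕ) : ∫ ξ, G j ξ = (triangleCoeff j : ℂ) *
      ((𝓕 k (x + (2 * j + 1) * s) - 𝓕 k (x - (2 * j + 1) * s)) / 2) := by
    rw [hF, hF, ← integral_sub (hei _) (hei _), ← integral_div, ← integral_const_mul]
    congr 1
    ext ξ
    simp only [hG]
    have h1 : e (x + (2 * j + 1) * s) ξ = e x ξ *
        Complex.exp (-((2 * j + 1) * (2 * Real.pi * ξ * s) : ℝ) * Complex.I) := by
      simp only [he]
      rw [← Complex.exp_add]
      congr 1
      push_cast
      ring
    have h2 : e (x - (2 * j + 1) * s) ξ = e x ξ *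
        Complex.exp (((2 * j + 1) * (2 * Real.pi * ξ * s) : ℝ) * Complex.I) := by
      simp only [he]
      rw [← Complex.exp_add]
      congr 1
      push_cast
      ring
    rw [h1, h2, Complex.ofReal_sin, Complex.sin]
    ring_nf
    rw [Complex.I_sq]
    ring
  have htot : ∫ ξ, (∑' j, G j ξ) =
      s * (-2 * Real.pi * Complex.I * 𝓕 (fun ξ : ℝ => (ξ : ℂ) * k ξ) x) := by
    rw [hF, ← integral_const_mul, ← integral_const_mul]
    congr 1
    ext ξ
    -- Either `k ξ = 0`, or `|2πξs| ≤ π / 2`, where the triangle wave equals its argument.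
    by_cases hξ : lam < 2 * Real.pi * |ξ|
    · simp [hG, hsupp ξ hξ]
    · have hu : |2 * Real.pi * ξ * s| ≤ Real.pi / 2 := by
        rw [abs_mul, abs_mul, abs_of_pos (by positivity : 0 < 2 * Real.pi), abs_of_pos hs0]
        calc 2 * Real.pi * |ξ| * s ≤ lam * s := by
              gcongr
              exact not_lt.1 hξ
          _ = Real.pi / 2 := by
              rw [hs]
              field_simp
      have h := (Complex.hasSum_ofReal.2 (hasSum_triangleCoeff_mul_sin hu)).mul_right
        (-Complex.I * (e x ξ * k ξ))
      have h' : ∑' j, G j ξ = ((2 * Real.pi * ξ * s : ℝ) : ℂ) * (-Complex.I * (e x ξ * k ξ)) := by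
        rw [← h.tsum_eq]
        congr 1
        ext j
        simp only [hG]
        push_cast
        ring
      rw [h']
      push_cast
      ring
  rw [htot] at hsum
  simpa only [hterm] using hsum

/-- Pairing with a difference of translates is pairing the opposite difference. -/
theorem BoundedTower.integral_mul_translate {F : ℕ → ℝ → ℂ} {M : ℕ → ℝ} (hF : BoundedTower F M)
    {κ : ℝ → ℂ} (hκ : Integrable κ) (t : ℝ) :
    ∫ x, F 0 x * ((κ (x + t) - κ (x - t)) / 2) = ∫ x, (F 0 (x - t) - F 0 (x + t)) / 2 * κ x := by
  have i1 := hF.integrable_mul 0 (hκ.comp_add_right t)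
  have i2 := hF.integrable_mul 0 (hκ.comp_sub_right t)
  have e1 := integral_add_right_eq_self (μ := volume) (fun x => F 0 (x - t) * κ x) t
  have e2 := integral_sub_right_eq_self (μ := volume) (fun x => F 0 (x + t) * κ x) t
  simp only [add_sub_cancel_right, sub_add_cancel] at e1 e2
  have j1 : Integrable fun x => F 0 (x - t) * κ x := by
    simpa using i1.comp_sub_right t
  have j2 : Integrable fun x => F 0 (x + t) * κ x := by
    simpa using i2.comp_add_right t
  calc ∫ x, F 0 x * ((κ (x + t) - κ (x - t)) / 2)
      = ∫ x, (F 0 x * κ (x + t) - F 0 x * κ (x - t)) / 2 := by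
        congr 1
        ext x
        ring
    _ = ((∫ x, F 0 x * κ (x + t)) - ∫ x, F 0 x * κ (x - t)) / 2 := by
        rw [integral_div, integral_sub i1 i2]
    _ = ∫ x, (F 0 (x - t) * κ x - F 0 (x + t) * κ x) / 2 := by
        rw [integral_div, integral_sub j1 j2, e1, e2]
    _ = _ := by
        congr 1
        ext x
        ring

/-! ### Bernstein's inequality on the line -/

namespace BoundedTower

variable {F : ℕ → ℝ → ℂ} {M : ℕ → ℝ} {C τ lam : ℝ}

/-- Bernstein's inequality, tested against the Fourier transform of `g`. -/
theorem norm_integral_deriv_mul_fourier_le (hF : BoundedTower F M) (hτ : 0 ≤ τ)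
    (hM : ∃ᶠ n in atTop, M n ≤ C * τ ^ n) (hlam : τ < lam) {g : ℝ → ℂ} (hg : IntegrableC2 g) :
    ‖∫ x, F 1 x * 𝓕 g x‖ ≤ lam * M 0 * ∫ x, ‖𝓕 g x‖ := by
  have hpi := Real.pi_pos
  have hlam0 : 0 < lam := hτ.trans_lt hlam
  -- The cutoff is `1` for `2π|ξ| ≤ (τ + lam) / 2`, a neighbourhood of the spectrum, and `0` for
  -- `2π|ξ| ≥ lam`, as the Riesz formula requires.
  let χ : ContDiffBump (0 : ℝ) :=
    ⟨(τ + lam) / (4 * Real.pi), lam / (2 * Real.pi), by positivity, by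
      rw [div_lt_div_iff₀ (by positivity) (by positivity)]
      nlinarith⟩
  have hχ : ContDiff ℝ 2 fun ξ : ℝ => (χ ξ : ℂ) := Complex.ofRealCLM.contDiff.comp χ.contDiff
  set k : ℝ → ℂ := fun ξ => (χ ξ : ℂ) * g ξ with hkdef
  have hkc : ContDiff ℝ 2 k := hχ.mul hg.contDiff
  have hks : HasCompactSupport k := by
    refine HasCompactSupport.mul_right (χ.hasCompactSupport.comp_left (g := Complex.ofReal) ?_)
    exact Complex.ofReal_zero
  have hk : IntegrableC2 k := IntegrableC2.of_hasCompactSupport hkc hks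
  have hk1 : IntegrableC2 fun ξ : ℝ => (ξ : ℂ) * k ξ :=
    IntegrableC2.of_hasCompactSupport (Complex.ofRealCLM.contDiff.mul hkc) hks.mul_left
  have hsupp : ∀ ξ, lam < 2 * Real.pi * |ξ| → k ξ = 0 := by
    intro ξ hξ
    have : χ ξ = 0 := by
      refine χ.zero_of_le_dist ?_
      rw [Real.dist_eq, sub_zero]
      change lam / (2 * Real.pi) ≤ |ξ|
      rw [div_le_iff₀' (by positivity)]
      exact hξ.le
    simp [hkdef, this]
  have hv : ∀ ξ, |ξ| < (τ + lam) / (4 * Real.pi) → (g - k) ξ = 0 := by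
    intro ξ hξ
    have : χ ξ = 1 := by
      refine χ.one_of_mem_closedBall ?_
      rw [Metric.mem_closedBall, Real.dist_eq, sub_zero]
      exact hξ.le
    simp [hkdef, this]
  have ha : τ < 2 * Real.pi * ((τ + lam) / (4 * Real.pi)) := by
    have : 2 * Real.pi * ((τ + lam) / (4 * Real.pi)) = (τ + lam) / 2 := by
      field_simp
      ring
    rw [this]
    linarith
  have hfsub (x : ℝ) : 𝓕 (g - k) x = 𝓕 g x - 𝓕 k x := by
    rw [Real.fourier_real_eq, Real.fourier_real_eq, Real.fourier_real_eq, ← integral_sub]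
    · simp only [Pi.sub_apply, smul_sub]
    · simpa [mul_comm] using (Real.fourierIntegral_convergent_iff x).2 hg.int
    · simpa [mul_comm] using (Real.fourierIntegral_convergent_iff x).2 hk.int
  -- Such towers cannot distinguish `g` from its truncation `k`. The constant is left free because
  -- the statement also serves the shifted tower.
  have hlow {H : ℕ → ℝ → ℂ} {N : ℕ → ℝ} {C' : ℝ} (hH : BoundedTower H N)
      (hN : ∃ᶠ n in atTop, N n ≤ C' * τ ^ n) :
      ∫ x, H 0 x * 𝓕 k x = ∫ x, H 0 x * 𝓕 g x := by
    have h := hH.integral_mul_fourier_eq_zero hτ ha hN (hg.sub hk) hv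
    simp only [hfsub, mul_sub] at h
    rw [integral_sub (hH.integrable_mul 0 hg.integrable_fourier)
      (hH.integrable_mul 0 hk.integrable_fourier)] at h
    exact (sub_eq_zero.1 h).symm
  have hM1 : ∃ᶠ n in atTop, M (n + 1) ≤ C * τ * τ ^ n := by
    rw [frequently_atTop] at hM ⊢
    intro N
    obtain ⟨n, hn, h⟩ := hM (N + 1)
    obtain ⟨m, rfl⟩ := Nat.exists_eq_add_of_lt hn
    refine ⟨N + m, Nat.le_add_right _ _, h.trans_eq ?_⟩
    rw [pow_succ]
    ring
  set κ := 𝓕 k with hκdef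
  have hκ : Integrable κ := hk.integrable_fourier
  have hg1 := hg.integrable_fourier
  set s := Real.pi / (2 * lam) with hs
  have hs0 : 0 < s := by positivity
  set κ' : ℝ → ℂ := fun x => -2 * Real.pi * Complex.I * 𝓕 (fun ξ : ℝ => (ξ : ℂ) * k ξ) x with hκ'
  have hparts : ∫ x, F 0 x * κ' x = -∫ x, F 1 x * κ x :=
    hF.integral_mul_deriv (IntegrableC2.hasDerivAt_fourier hk.int hk1.int) hκ
      (hk1.integrable_fourier.const_mul _)
  set G : ℕ → ℝ → ℂ := fun j x => (triangleCoeff j : ℂ) *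
    (F 0 x * ((κ (x + (2 * j + 1) * s) - κ (x - (2 * j + 1) * s)) / 2)) with hG
  have hW (t : ℝ) : Integrable (fun x => (κ (x + t) - κ (x - t)) / 2) :=
    ((hκ.comp_add_right t).sub (hκ.comp_sub_right t)).div_const 2
  have hWle (t : ℝ) : ∫ x, ‖(κ (x + t) - κ (x - t)) / 2‖ ≤ ∫ x, ‖κ x‖ := by
    have i1 := (hκ.comp_add_right t).norm
    have i2 := (hκ.comp_sub_right t).norm
    calc ∫ x, ‖(κ (x + t) - κ (x - t)) / 2‖ ≤ ∫ x, (‖κ (x + t)‖ + ‖κ (x - t)‖) / 2 := by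
          refine integral_mono (hW t).norm ((i1.add i2).div_const 2) fun x => ?_
          rw [norm_div, Complex.norm_ofNat]
          gcongr
          exact norm_sub_le _ _
      _ = ∫ x, ‖κ x‖ := by
          rw [integral_div, integral_add i1 i2,
            integral_add_right_eq_self (fun x => ‖κ x‖), integral_sub_right_eq_self (fun x => ‖κ x‖)]
          ring
  have hGi (j : ℕ) : Integrable (G j) := (hF.integrable_mul 0 (hW _)).const_mul _
  have hGs : Summable fun j => ∫ x, ‖G j x‖ := by
    refine Summable.of_nonneg_of_le (fun j => by positivity) (fun j => ?_)
      (hasSum_abs_triangleCoeff.summable.mul_right (M 0 * ∫ x, ‖κ x‖))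
    calc ∫ x, ‖G j x‖ ≤ ∫ x, |triangleCoeff j| * (M 0 *
          ‖(κ (x + (2 * j + 1) * s) - κ (x - (2 * j + 1) * s)) / 2‖) := by
          refine integral_mono (hGi j).norm (((hW _).norm.const_mul _).const_mul _) fun x => ?_
          simp only [hG]
          rw [norm_mul, norm_mul, Complex.norm_real, Real.norm_eq_abs]
          gcongr
          exact hF.norm_le 0 x
      _ ≤ _ := by
          rw [integral_const_mul, integral_const_mul]
          have := hF.nonneg 0
          exact mul_le_mul_of_nonneg_left (mul_le_mul_of_nonneg_left (hWle _) this) (abs_nonneg _)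
  have hsum := hasSum_integral_of_summable_integral_norm hGi hGs
  have htot : ∫ x, (∑' j, G j x) = s * ∫ x, F 0 x * κ' x := by
    rw [← integral_const_mul]
    congr 1
    ext x
    have h := (hasSum_riesz_fourier hlam0 hs hk.int hsupp x).mul_left (F 0 x)
    rw [show (s : ℂ) * (F 0 x * κ' x) = F 0 x * (s * κ' x) by ring]
    simp only [hκ']
    rw [← h.tsum_eq]
    congr 1
    ext j
    simp only [hG]
    ring
  -- Once the translates are moved onto `F`, `k` is replaced by `g`; the bound then avoids the `L¹`
  -- norm of `𝓕 k`, which depends on the cutoff.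
  have hterm (j : ℕ) : ‖∫ x, G j x‖ ≤ |triangleCoeff j| * (M 0 * ∫ x, ‖𝓕 g x‖) := by
    simp only [hG]
    rw [integral_const_mul, hF.integral_mul_translate hκ, norm_mul, Complex.norm_real,
      Real.norm_eq_abs]
    have hD := hF.symmDiff ((2 * j + 1) * s)
    have h1 := hlow hD hM
    rw [h1]
    exact mul_le_mul_of_nonneg_left (hD.norm_integral_mul_le 0 hg1) (abs_nonneg _)
  have hbound : ‖(s : ℂ) * ∫ x, F 0 x * κ' x‖ ≤ Real.pi / 2 * (M 0 * ∫ x, ‖𝓕 g x‖) := by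
    rw [← htot, ← hsum.tsum_eq]
    exact tsum_of_norm_bounded (hasSum_abs_triangleCoeff.mul_right _) hterm
  rw [norm_mul, Complex.norm_real, Real.norm_eq_abs, abs_of_pos hs0, hparts, norm_neg,
    hlow hF.shift hM1, ← le_div_iff₀' hs0] at hbound
  refine hbound.trans_eq ?_
  rw [hs]
  field_simp

/-- **Bernstein's inequality** on the line, for functions whose derivatives satisfy
`‖F⁽ⁿ⁾‖ ≤ C τ ^ n` infinitely often. -/
theorem norm_deriv_le (hF : BoundedTower F M) (hτ : 0 ≤ τ)
    (hM : ∃ᶠ n in atTop, M n ≤ C * τ ^ n) : ‖F 1 0‖ ≤ τ * M 0 := by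
  have key : ∀ lam, τ < lam → ∀ ε > 0, ‖F 1 0‖ ≤ lam * M 0 + ε := by
    intro lam hlam ε hε
    obtain ⟨δ, hδ, hball⟩ := Metric.continuousAt_iff.1 (hF.continuous 1).continuousAt ε hε
    -- Choosing `g` as the inverse transform of a mollifier of mass `1` makes the pairing an average
    -- of `F 1` near `0`.
    let φ : ContDiffBump (0 : ℝ) := ⟨δ / 2, δ, by positivity, by linarith⟩
    have hφc : HasCompactSupport fun x : ℝ => (φ.normed volume x : ℂ) :=
      φ.hasCompactSupport_normed.comp_left (g := Complex.ofReal) Complex.ofReal_zero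
    have hφd : ContDiff ℝ (⊤ : ℕ∞) fun x : ℝ => (φ.normed volume x : ℂ) :=
      Complex.ofRealCLM.contDiff.comp φ.contDiff_normed
    let η : SchwartzMap ℝ ℂ := hφc.toSchwartzMap hφd
    have hηx (x : ℝ) : η x = (φ.normed volume x : ℂ) := rfl
    have hinv : 𝓕 (𝓕⁻ η : SchwartzMap ℝ ℂ) = η := FourierTransform.fourier_fourierInv_eq η
    have hinv' : 𝓕 ((𝓕⁻ η : SchwartzMap ℝ ℂ) : ℝ → ℂ) = η := by
      rw [← SchwartzMap.fourier_coe, hinv]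
    have h := hF.norm_integral_deriv_mul_fourier_le hτ hM hlam
      (IntegrableC2.of_schwartz (𝓕⁻ η : SchwartzMap ℝ ℂ))
    rw [hinv'] at h
    have hnorm : ∫ x, ‖η x‖ = 1 := by
      rw [← φ.integral_normed (μ := volume)]
      congr 1
      ext x
      rw [hηx, Complex.norm_real, Real.norm_eq_abs, abs_of_nonneg (φ.nonneg_normed x)]
    rw [hnorm, mul_one] at h
    have hone : ∫ x, η x = 1 := by
      simp only [hηx]
      rw [integral_complex_ofReal, φ.integral_normed, Complex.ofReal_one]
    have hdiff : F 1 0 - ∫ x, F 1 x * η x = ∫ x, (F 1 0 - F 1 x) * η x := by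
      simp only [sub_mul]
      rw [integral_sub (η.integrable.const_mul _) (hF.integrable_mul 1 η.integrable),
        integral_const_mul, hone, mul_one]
    have hdle : ‖F 1 0 - ∫ x, F 1 x * η x‖ ≤ ε := by
      rw [hdiff]
      refine (norm_integral_le_of_norm_le (η.integrable.norm.const_mul ε)
        (Eventually.of_forall fun x => ?_)).trans_eq ?_
      · rw [norm_mul]
        by_cases hx : |x| < δ
        · gcongr
          rw [← dist_eq_norm, dist_comm]
          exact (hball (by simpa [Real.dist_eq] using hx)).le
        · have : η x = 0 := by
            rw [hηx, φ.normed_def, φ.zero_of_le_dist (by simpa [Real.dist_eq] using hx), zero_div,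
              Complex.ofReal_zero]
          simp [this]
      · rw [integral_const_mul, hnorm, mul_one]
    calc ‖F 1 0‖ = ‖(∫ x, F 1 x * η x) + (F 1 0 - ∫ x, F 1 x * η x)‖ := by
          rw [add_sub_cancel]
      _ ≤ _ := (norm_add_le _ _).trans (add_le_add h hdle)
  have key2 : ∀ lam, τ < lam → ‖F 1 0‖ ≤ lam * M 0 := fun lam hlam =>
    le_of_forall_pos_le_add (key lam hlam)
  have hlim : Tendsto (fun lam => lam * M 0) (𝓝[>] τ) (𝓝 (τ * M 0)) :=
    ((continuous_id.mul continuous_const).tendsto τ).mono_left nhdsWithin_le_nhds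
  exact ge_of_tendsto hlim (eventually_mem_nhdsWithin.mono fun lam hl => key2 lam hl)

end BoundedTower

end FourierSide

/-! ### Transfer to orbits of the group -/

variable {𝕜 E : Type*} [RCLike 𝕜] [NormedAddCommGroup E] [NormedSpace 𝕜 E]

theorem hasDerivAt_orbit [NormedSpace ℝ E] [IsScalarTower ℝ 𝕜 E] {T : IsometryGroup 𝕜 E} {f g : E}
    (h : IsGeneratorValue T f g) (t : ℝ) : HasDerivAt (fun t => T.op t f) (T.op t g) t := by
  rw [hasDerivAt_iff_tendsto_slope_zero]
  refine (((T.op t).continuous.tendsto g).comp h).congr fun r => ?_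
  rw [Function.comp_apply, map_smul, map_sub, ← T.op_add, RCLike.real_smul_eq_coe_smul (K := 𝕜)]

theorem isGeneratorValue_powApply {T : IsometryGroup 𝕜 E} (f : smoothDomain T.generator) (k : ℕ) :
    IsGeneratorValue T (powApply T.generator k f) (powApply T.generator (k + 1) f) := by
  obtain ⟨h1, h2⟩ := (mem_opComp_domain T.generator (opPow T.generator k) f).1
    (mem_opPow_domain f.2 (k + 1))
  exact T.generator_spec ⟨_, h2⟩

theorem powApply_zero (D : E →ₗ.[𝕜] E) (f : smoothDomain D) : powApply D 0 f = f := rfl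

/-- The scalar orbits of the vectors `D ^ k f` form a tower of derivatives. -/
theorem boundedTower_orbit [NormedSpace ℝ E] [IsScalarTower ℝ 𝕜 E] {T : IsometryGroup 𝕜 E}
    (f : smoothDomain T.generator) (j : ℕ) {φ : StrongDual ℝ E} (hφ : ‖φ‖ ≤ 1) :
    BoundedTower (fun n t => ((φ (T.op t (powApply T.generator (j + n) f)) : ℝ) : ℂ))
      (fun n => ‖powApply T.generator (j + n) f‖) where
  hasDerivAt n t :=
    (φ.hasFDerivAt.comp_hasDerivAt t
      (hasDerivAt_orbit (isGeneratorValue_powApply f (j + n)) t)).ofReal_comp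
  norm_le n t := by
    rw [Complex.norm_real]
    refine (φ.le_of_opNorm_le hφ _).trans_eq ?_
    rw [one_mul, LinearIsometry.norm_map]

/-- Bernstein's inequality for the scalar orbit of `D ^ j f`: isometry bounds every derivative by
the norm of the corresponding `D ^ (j + n) f`, and the functional recovers the full norm of `D ^ (j
+ 1) f` at time `0`. -/
theorem norm_powApply_succ_le {T : IsometryGroup 𝕜 E} (f : smoothDomain T.generator) {τ : ℝ}
    (hτ : 0 ≤ τ) (h : ∃ᶠ n in atTop, ‖powApply T.generator n f‖ ≤ τ ^ n) (j : ℕ) :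
    ‖powApply T.generator (j + 1) f‖ ≤ τ * ‖powApply T.generator j f‖ := by
  let _ : NormedSpace ℝ E := NormedSpace.restrictScalars ℝ 𝕜 E
  have : IsScalarTower ℝ 𝕜 E := IsScalarTower.of_algebraMap_smul fun _ _ => rfl
  obtain ⟨φ, hφ, hval⟩ := exists_dual_vector'' ℝ (powApply T.generator (j + 1) f)
  have hM : ∃ᶠ n in atTop, ‖powApply T.generator (j + n) f‖ ≤ τ ^ j * τ ^ n := by
    rw [frequently_atTop] at h ⊢
    intro N
    obtain ⟨n, hn, hle⟩ := h (j + N)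
    obtain ⟨m, rfl⟩ := Nat.exists_eq_add_of_le hn
    refine ⟨N + m, Nat.le_add_right _ _, ?_⟩
    rwa [← pow_add, ← add_assoc]
  have hb := (boundedTower_orbit f j hφ).norm_deriv_le hτ hM
  simpa [T.op_zero, hval] using hb

/-- A smooth vector with `‖D ^ n f‖ ≤ τ ^ n` for infinitely many `n` lies in `B_τ(D)`. -/
theorem mem_bernsteinSpace_of_frequently {T : IsometryGroup 𝕜 E} (f : smoothDomain T.generator)
    {τ : ℝ} (hτ : 0 ≤ τ) (h : ∃ᶠ n in atTop, ‖powApply T.generator n f‖ ≤ τ ^ n) :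
    (f : E) ∈ bernsteinSpace T.generator τ := by
  refine ⟨f.2, fun k => ?_⟩
  induction k with
  | zero => rw [powApply_zero, pow_zero, one_mul]
  | succ k ih =>
    refine (norm_powApply_succ_le f hτ h k).trans ?_
    rw [pow_succ', mul_assoc]
    exact mul_le_mul_of_nonneg_left ih hτ

theorem mem_bernsteinSpace_of_frequently_root_le {T : IsometryGroup 𝕜 E}
    (f : smoothDomain T.generator) {τ : ℝ}
    (h : ∃ᶠ k : ℕ in atTop, ‖powApply T.generator k f‖ ^ (1 / (k : ℝ)) ≤ τ) :
    0 ≤ τ ∧ (f : E) ∈ bernsteinSpace T.generator τ := by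
  have hτ : 0 ≤ τ := by
    obtain ⟨k, hk⟩ := h.exists
    exact (Real.rpow_nonneg (norm_nonneg _) _).trans hk
  refine ⟨hτ, mem_bernsteinSpace_of_frequently f hτ ?_⟩
  -- The index `0` is dropped because `1 / 0 = 0` there, so the root cannot be undone.
  refine (h.and_eventually (eventually_ne_atTop 0)).mono fun k hk => ?_
  have h1 := pow_le_pow_left₀ (Real.rpow_nonneg (norm_nonneg _) _) hk.1 k
  rwa [one_div, Real.rpow_inv_natCast_pow (norm_nonneg _) hk.2] at h1

/-! ### The Bernstein index as a limit of roots -/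

theorem exists_isLeast_bernsteinSpace {D : E →ₗ.[𝕜] E} {f : E} {σ : ℝ} (hσ : 0 ≤ σ)
    (hf : f ∈ bernsteinSpace D σ) : ∃ s, IsLeast {σ : ℝ | 0 ≤ σ ∧ f ∈ bernsteinSpace D σ} s := by
  have e : {σ : ℝ | 0 ≤ σ ∧ f ∈ bernsteinSpace D σ} =
      {σ : ℝ | 0 ≤ σ} ∩ ⋂ k, {σ : ℝ | ‖powApply D k ⟨f, mem_smoothDomain hf⟩‖ ≤ σ ^ k * ‖f‖} := by
    ext σ
    simp only [Set.mem_ofPred_eq, Set.mem_inter_iff, Set.mem_iInter]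
    exact and_congr_right fun _ => ⟨fun h => h.2, fun h => ⟨_, h⟩⟩
  have hc : IsClosed {σ : ℝ | 0 ≤ σ ∧ f ∈ bernsteinSpace D σ} := by
    rw [e]
    exact (isClosed_le continuous_const continuous_id).inter (isClosed_iInter fun k =>
      isClosed_le continuous_const (by fun_prop))
  exact ⟨_, hc.isLeast_csInf ⟨σ, hσ, hf⟩ ⟨0, fun _ h => h.1⟩⟩

theorem tendsto_root_norm_powApply {T : IsometryGroup 𝕜 E} {f : E}
    (hf : f ∈ smoothDomain T.generator) {s : ℝ}
    (hs : IsLeast {σ : ℝ | 0 ≤ σ ∧ f ∈ bernsteinSpace T.generator σ} s) :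
    Tendsto (fun k : ℕ => ‖powApply T.generator k ⟨f, hf⟩‖ ^ (1 / (k : ℝ))) atTop (𝓝 s) := by
  obtain ⟨⟨hs0, _, hle⟩, hmin⟩ := hs
  refine tendsto_order.2 ⟨fun a ha => ?_, fun b hb => ?_⟩
  · by_contra hcon
    rw [not_eventually] at hcon
    simp only [not_lt] at hcon
    exact ha.not_ge (hmin (mem_bernsteinSpace_of_frequently_root_le ⟨f, hf⟩ hcon))
  -- Using `‖f‖ + 1` keeps the base nonzero, so its `k`-th root tends to `1` even when `f = 0`.
  · have hpos : ‖f‖ + 1 ≠ 0 := by positivity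
    have hlim : Tendsto (fun k : ℕ => s * (‖f‖ + 1) ^ (1 / (k : ℝ))) atTop (𝓝 s) := by
      have h1 := ((Real.continuousAt_const_rpow (b := 0) hpos).tendsto.comp
        tendsto_one_div_atTop_nhds_zero_nat).const_mul s
      simpa only [Function.comp_apply, Real.rpow_zero, mul_one] using h1
    filter_upwards [(tendsto_order.1 hlim).2 b hb, eventually_ne_atTop 0] with k hk hk0
    refine lt_of_le_of_lt ?_ hk
    calc ‖powApply T.generator k ⟨f, hf⟩‖ ^ (1 / (k : ℝ))
        ≤ (s ^ k * (‖f‖ + 1)) ^ (1 / (k : ℝ)) := by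
          refine Real.rpow_le_rpow (norm_nonneg _) ((hle k).trans ?_) (by positivity)
          exact mul_le_mul_of_nonneg_left (by linarith) (by positivity)
      _ = s * (‖f‖ + 1) ^ (1 / (k : ℝ)) := by
          rw [Real.mul_rpow (by positivity) (by positivity), one_div,
            Real.pow_rpow_inv_natCast hs0 hk0]

end BernsteinVectors

theorem mainTheorem4 {𝕜 E : Type*} [RCLike 𝕜] [NormedAddCommGroup E] [NormedSpace 𝕜 E]
    [CompleteSpace E] (T : BernsteinVectors.IsometryGroup 𝕜 E) :
    (∀ (f : E) (σ : ℝ), 0 < σ →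
      ∀ hf : f ∈ BernsteinVectors.bernsteinSpace T.generator σ,
        ∃ d : ℝ,
          Tendsto
            (fun k : ℕ =>
              ‖BernsteinVectors.powApply T.generator k
                ⟨f, BernsteinVectors.mem_smoothDomain hf⟩‖ ^ (1 / (k : ℝ)))
            atTop (𝓝 d) ∧
          (d : EReal) = BernsteinVectors.bernsteinIndex T.generator f) ∧
    (∀ (f : E) (hf : f ∈ BernsteinVectors.smoothDomain T.generator) (d : ℝ),
      Tendsto
        (fun k : ℕ => ‖BernsteinVectors.powApply T.generator k ⟨f, hf⟩‖ ^ (1 / (k : ℝ)))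
        atTop (𝓝 d) →
      f ∈ BernsteinVectors.bernsteinSpace T.generator d ∧
      (d : EReal) = BernsteinVectors.bernsteinIndex T.generator f) := by
  refine ⟨fun f σ hσ hf => ?_, fun f hf d hd => ?_⟩
  · obtain ⟨s, hs⟩ := BernsteinVectors.exists_isLeast_bernsteinSpace hσ.le hf
    exact ⟨s, BernsteinVectors.tendsto_root_norm_powApply _ hs,
      ((BernsteinVectors.bernsteinIndex_eq_coe_iff _ _ _).2 hs).symm⟩
  · have hev : ∃ᶠ k : ℕ in atTop,
        ‖BernsteinVectors.powApply T.generator k ⟨f, hf⟩‖ ^ (1 / (k : ℝ)) ≤ d + 1 :=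
      ((tendsto_order.1 hd).2 (d + 1) (lt_add_one d)).frequently.mono fun _ h => h.le
    obtain ⟨h0, hmem⟩ := BernsteinVectors.mem_bernsteinSpace_of_frequently_root_le ⟨f, hf⟩ hev
    obtain ⟨s, hs⟩ := BernsteinVectors.exists_isLeast_bernsteinSpace h0 hmem
    obtain rfl : d = s :=
      tendsto_nhds_unique hd (BernsteinVectors.tendsto_root_norm_powApply hf hs)
    exact ⟨hs.1.2, ((BernsteinVectors.bernsteinIndex_eq_coe_iff _ _ _).2 hs).symm⟩
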